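/- Let $1/2<p\le 1$ and $q=1-p$. Consider the asymmetric simple exclusion process (ASEP) on $\mathbb{Z}$: the continuous-time Markov process $(\eta_\ell)_{\ell\ge 0}$ with càdlàg paths in $\{0,1\}^{\mathbb{Z}}$ (where $\eta_\ell(i)=1$ means that site $i$ is occupied at time $\ell$) in which each particle attempts, independently of the others, a jump one step to the right at rate $p$ and one step to the left at rate $q$, an attempted jump being carried out if and only if the target site is empty. Its generator acts on functions $f$ of finitely many sites by $$Lf(\eta)=\sum_{i\in\mathbb{Z}}\bigl[p\,\eta(i)(1-\eta(i+1))+q\,\eta(i+1)(1-\eta(i))\bigr]\bigl[f(\eta^{i,i+1})-f(\eta)\bigr],$$ where $\eta^{i,i+1}$ is $\eta$ with the contents of the sites $i$ and $i+1$ exchanged. Start the process from the reversed step initial data $\eta_0=\mathbf{1}_{\{i\ge 0\}}$, that is, with particles exactly at the sites $0,1,2,\dots$, and let $x_0(\ell)$ be the position of the leftmost particle at time $\ell$, so that $x_0(0)=0$. Then there are constants $t_0,C_1,C_2>0$, depending only on $p$, such that for all $t>t_0$ $$\mathbb{P}\Bigl(\inf_{0\le \ell\le t}x_0(\ell)<-t^{1/4}\Bigr)\le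 C_1e^{-C_2t^{1/8}}.$$ -/

import Mathlib

open MeasureTheory Filter Topology
open scoped NNReal

noncomputable section

namespace ASEP

/-- Particle configurations on `ℤ`, i.e. elements of `{0,1}^ℤ` (`η i = true` means that site `i`
is occupied), with the product topology and the product `σ`-algebra. -/
abbrev Config : Type := ℤ → Bool

/-- The configuration obtained from `η` by exchanging the contents of the sites `i` and `i + 1`. -/
def exchange (η : Config) (i : ℤ) : Config := fun j => η (Equiv.swap i (i + 1) j)

/-- Rate of the exchange across the bond `{i, i + 1}`: a particle at `i` jumps to `i + 1` at rate
`p` if `i + 1` is empty, and a particle at `i + 1` jumps to `i` at rate `1 - p` if `i` is empty. -/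
def rate (p : ℝ) (η : Config) (i : ℤ) : ℝ :=
  if η i = true ∧ η (i + 1) = false then p
  else if η i = false ∧ η (i + 1) = true then 1 - p
  else 0

/-- Cylinder functions: real functions of the configuration that depend on finitely many sites. -/
def IsCylinder (f : Config → ℝ) : Prop := ∃ S : Finset ℤ, DependsOn f (S : Set ℤ)

/-- The generator of the ASEP. If `f` is a cylinder function, then only finitely many terms of the
sum are nonzero. -/
def generator (p : ℝ) (f : Config → ℝ) (η : Config) : ℝ :=
  ∑ᶠ i : ℤ, rate p η i * (f (exchange η i) - f η)

/-- `η` is an ASEP on `ℤ` with jump rate `p` to the right and `1 - p` to the left: a process with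
values in `{0,1}^ℤ` and càdlàg paths that solves the martingale problem of the generator on the
cylinder functions, with respect to its own filtration. (Cylinder functions form a core for the
Feller generator of the ASEP, so this martingale problem is well posed, and its solutions are
exactly the càdlàg versions of the ASEP.) -/
structure IsASEP {Ω : Type*} [MeasurableSpace Ω] (p : ℝ) (μ : Measure Ω)
    (η : ℝ≥0 → Ω → Config) : Prop where
  measurable : ∀ t, Measurable (η t)
  right_continuous : ∀ ω t, ContinuousWithinAt (fun s => η s ω) (Set.Ici t) t
  left_limits : ∀ ω t, ∃ ξ : Config, Tendsto (fun s => η s ω) (𝓝[<] t) (𝓝 ξ)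
  martingale : ∀ f : Config → ℝ, IsCylinder f →
    Martingale
      (fun t ω => f (η t ω) - ∫ s in (0 : ℝ)..(t : ℝ), generator p f (η s.toNNReal ω))
      (Filtration.natural η (fun t => (measurable t).stronglyMeasurable)) μ

/-- The reversed step configuration `1_{i ≥ 0}`: the particles are at `0, 1, 2, …`. -/
def reversedStep : Config := fun i => decide (0 ≤ i)

/-- The position of the leftmost particle, as an extended real number: `⊤` if there is no particle
and `⊥` if there are particles arbitrarily far to the left. Particles keep their order, so the
particle that starts leftmost stays leftmost. -/
def leftmost (η : Config) : EReal := ⨅ (i : ℤ) (_ : η i = true), ((i : ℝ) : EReal)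

end ASEP

end

/-! Fix `z > 1` with `(1 - p) * z ≤ p`. The blocking measures suggest that, to the left of the
origin, the density decays like `z ^ x` uniformly in time; this is `IsASEP.mean_occ_le`. A
first-moment bound then shows that sites beyond `-t ^ (1/4)` are unlikely ever to be visited before
time `t`.

The density bound rests on an inequality version of the Gärtner transform: `z` to the number of
particles left of `x` has an expectation that is a subsolution of a linear heat equation
(`generator_expCount_le`). The functions `1` and `z ^ x` are stationary solutions, and `1 + z ^ (x +
1)` dominates the initial data, so comparison (`nonpos_of_heat_subsolution`) preserves the bound.
Only cylinder functions are available, so particles are counted in `[1 - n, x]`; the resulting flux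
through the left end is controlled by finite propagation speed and vanishes as `n → ∞`.

To pass from fixed times to the whole interval `[0, t]`, a maximal inequality for the Dynkin
martingale of one occupation number bounds the probability of a visit to site `i` by the expected
inflow, at most a constant times `t * z ^ i`. Summing over `i < -m` with `m = ⌊t ^ (1/4)⌋` gives a
decay `exp (-c t ^ (1/4))`, stronger than required. -/

noncomputable section

namespace ASEP

/-! ### Cylinder functions and the generator -/

section Cylinder

variable {f : Config → ℝ}

lemma IsCylinder.exists_comp (hf : IsCylinder f) :
    ∃ (S : Finset ℤ) (g : ((i : (S : Set ℤ)) → Bool) → ℝ), f = g ∘ (S : Set ℤ).domRestrict := by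
  obtain ⟨S, hS⟩ := hf
  exact ⟨S, dependsOn_iff_exists_comp.1 hS⟩

lemma IsCylinder.continuous (hf : IsCylinder f) : Continuous f := by
  obtain ⟨S, g, rfl⟩ := hf.exists_comp
  have hg : Continuous g := continuous_of_discreteTopology
  exact hg.comp (by unfold Set.domRestrict; fun_prop)

lemma IsCylinder.measurable (hf : IsCylinder f) : Measurable f :=
  hf.continuous.measurable

lemma IsCylinder.exists_bound (hf : IsCylinder f) : ∃ C, ∀ η, |f η| ≤ C := by
  obtain ⟨S, g, rfl⟩ := hf.exists_comp
  obtain ⟨C, hC⟩ := (Set.finite_range fun x => |g x|).bddAbove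
  exact ⟨C, fun η => hC ⟨_, rfl⟩⟩

lemma exchange_of_ne (η : Config) {i j : ℤ} (h : j ≠ i) (h' : j ≠ i + 1) :
    exchange η i j = η j := by
  simp [exchange, Equiv.swap_apply_of_ne_of_ne h h']

@[simp] lemma exchange_left (η : Config) (i : ℤ) : exchange η i i = η (i + 1) := by
  simp [exchange]

@[simp] lemma exchange_right (η : Config) (i : ℤ) : exchange η i (i + 1) = η i := by
  simp [exchange]

lemma generator_eq_sum (p : ℝ) {η : Config} (T : Finset ℤ)
    (hT : ∀ i ∉ T, f (exchange η i) = f η) :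
    generator p f η = ∑ i ∈ T, rate p η i * (f (exchange η i) - f η) := by
  refine finsum_eq_sum_of_support_subset _ fun i hi => ?_
  by_contra h
  exact hi (by simp [hT i h])

/-- Only bonds touching the support of `f` contribute, and their rates are local. Closure under the
generator makes the mean of `generator p f` continuous in time for positive times, hence the mean of
`f` differentiable. -/
lemma IsCylinder.generator (hf : IsCylinder f) (p : ℝ) : IsCylinder (generator p f) := by
  obtain ⟨S, hS⟩ := hf
  let T : Finset ℤ := S ∪ S.image (· - 1)
  have hT : ∀ η : Config, ∀ i ∉ T, f (exchange η i) = f η := by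
    intro η i hi
    refine hS fun j hj => exchange_of_ne _ ?_ ?_
    · rintro rfl
      exact hi (Finset.mem_union_left _ hj)
    · rintro rfl
      exact hi (Finset.mem_union_right _ (Finset.mem_image.2 ⟨_, hj, by ring⟩))
  refine ⟨S ∪ T ∪ T.image (· + 1), fun η ξ h => ?_⟩
  rw [generator_eq_sum p T (hT η), generator_eq_sum p T (hT ξ)]
  have hSS : ∀ j ∈ S, η j = ξ j := fun j hj => h j (by simp [hj])
  refine Finset.sum_congr rfl fun i hi => ?_
  have h0 : η i = ξ i := h i (by
    exact_mod_cast Finset.mem_union_left _ (Finset.mem_union_right _ hi))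
  have h1 : η (i + 1) = ξ (i + 1) := h (i + 1) (by
    exact_mod_cast Finset.mem_union_right _ (Finset.mem_image_of_mem _ hi))
  have hr : rate p η i = rate p ξ i := by simp only [rate, h0, h1]
  have hx : f (exchange η i) = f (exchange ξ i) := by
    refine hS fun j hj => ?_
    by_cases hji : j = i
    · subst hji; simp [h1]
    by_cases hji' : j = i + 1
    · subst hji'; simp [h0]
    rw [exchange_of_ne _ hji hji', exchange_of_ne _ hji hji', hSS j hj]
  rw [hr, hx, hS hSS]

end Cylinder

/-! ### Occupation numbers -/

section Occupation

/-- The occupation number of the site `i`, as a real number. -/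
def occ (i : ℤ) (η : Config) : ℝ := if η i = true then 1 else 0

lemma occ_nonneg (i : ℤ) (η : Config) : 0 ≤ occ i η := by
  unfold occ; split_ifs <;> norm_num

lemma occ_le_one (i : ℤ) (η : Config) : occ i η ≤ 1 := by
  unfold occ; split_ifs <;> norm_num

lemma isCylinder_occ (i : ℤ) : IsCylinder (occ i) :=
  ⟨{i}, fun η ξ h => by simp [occ, h i (by simp)]⟩

/-- Drop the outflow and ignore exclusion: what remains is the largest possible inflow from the two
neighbours. -/
lemma generator_occ_le {p : ℝ} (hp : 0 ≤ p) (hp1 : p ≤ 1) (i : ℤ) (η : Config) :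
    generator p (occ i) η ≤ p * occ (i - 1) η + (1 - p) * occ (i + 1) η := by
  rw [generator_eq_sum p {i - 1, i}, Finset.sum_pair (by simp)]
  · have h1 : exchange η (i - 1) i = η (i - 1) := by
      simpa using exchange_right η (i - 1)
    simp only [occ, h1, exchange_left, rate, sub_add_cancel]
    cases η (i - 1) <;> cases η i <;> cases η (i + 1) <;> simp <;> linarith
  · intro j hj
    simp only [Finset.mem_insert, Finset.mem_singleton, not_or] at hj
    unfold occ
    rw [exchange_of_ne _ (Ne.symm hj.2) (fun h => hj.1 (by linarith))]

end Occupation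

/-! ### Exponential particle counts (Gärtner transform) -/

section Count

/-- The number of particles in the interval `[a, x]`. -/
def count (a x : ℤ) (η : Config) : ℕ := ∑ k ∈ Finset.Icc a x, (η k).toNat

/-- The exponential of the number of particles in `[a, x]`, to the base `z`. -/
def expCount (z : ℝ) (a x : ℤ) (η : Config) : ℝ := z ^ count a x η

lemma isCylinder_expCount (z : ℝ) (a x : ℤ) : IsCylinder (expCount z a x) :=
  ⟨Finset.Icc a x, fun η ξ h => by
    simp only [expCount, count, Finset.sum_congr rfl fun k hk => congrArg Bool.toNat (h k hk)]⟩

lemma count_of_lt {a x : ℤ} (h : x < a) (η : Config) : count a x η = 0 := by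
  simp [count, h]

lemma count_eq_add_right {a x : ℤ} (h : a ≤ x) (η : Config) :
    count a x η = count a (x - 1) η + (η x).toNat := by
  have : Finset.Icc a x = insert x (Finset.Icc a (x - 1)) := by ext; simp; omega
  rw [count, this, Finset.sum_insert (by simp), add_comm, count]

lemma count_eq_add_left {a x : ℤ} (h : a ≤ x) (η : Config) :
    count a x η = (η a).toNat + count (a + 1) x η := by
  have : Finset.Icc a x = insert a (Finset.Icc (a + 1) x) := by ext; simp; omega
  rw [count, this, Finset.sum_insert (by simp), count]

lemma count_le {a x : ℤ} (h : a ≤ x + 1) (η : Config) : (count a x η : ℤ) ≤ x + 1 - a := by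
  have : count a x η ≤ (Finset.Icc a x).card • 1 :=
    Finset.sum_le_card_nsmul _ _ _ fun k _ => Bool.toNat_le _
  simp at this
  omega

lemma count_exchange_outside {a x i : ℤ} (h : i < a - 1 ∨ x < i) (η : Config) :
    count a x (exchange η i) = count a x η := by
  refine Finset.sum_congr rfl fun k hk => ?_
  rw [Finset.mem_Icc] at hk
  rw [exchange_of_ne] <;> omega

lemma count_exchange_inside {a x i : ℤ} (h : a ≤ i) (h' : i < x) (η : Config) :
    count a x (exchange η i) = count a x η := by
  refine Finset.sum_equiv (Equiv.swap i (i + 1)) (fun k => ?_) fun k _ => rfl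
  simp only [Finset.mem_Icc]
  by_cases hk : k = i
  · subst hk; simp; omega
  by_cases hk' : k = i + 1
  · subst hk'; simp; omega
  rw [Equiv.swap_apply_of_ne_of_ne hk hk']

lemma one_le_expCount {z : ℝ} (hz : 1 ≤ z) (a x : ℤ) (η : Config) : 1 ≤ expCount z a x η :=
  one_le_pow₀ hz

lemma expCount_le {z : ℝ} (hz : 1 ≤ z) {a x : ℤ} (h : a ≤ x + 1) (η : Config) :
    expCount z a x η ≤ z ^ (x + 1 - a) := by
  rw [expCount, ← zpow_natCast]
  exact zpow_le_zpow_right₀ hz (count_le h η)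

lemma occ_le_expCount {z : ℝ} (hz : 1 ≤ z) {a x : ℤ} (h : a ≤ x) (η : Config) :
    (z - 1) * occ x η ≤ expCount z a x η - 1 := by
  have h1 := one_le_expCount hz a (x - 1) η
  unfold occ
  unfold expCount at *
  rw [count_eq_add_right h, pow_add]
  cases η x
  · simpa using h1
  · simp; nlinarith

/-- At most `x + 1` initial particles lie in the window when `x ≥ 0`, and none when `x < 0`. -/
lemma expCount_reversedStep_le {z : ℝ} (hz : 1 ≤ z) (a x : ℤ) :
    expCount z a x reversedStep - 1 ≤ z ^ (x + 1) := by
  have hz0 : 0 < z := by linarith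
  rcases lt_or_ge x 0 with hx | hx
  · have : count a x reversedStep = 0 := by
      refine Finset.sum_eq_zero fun k hk => ?_
      rw [Finset.mem_Icc] at hk
      simp [reversedStep]
      omega
    simp [expCount, this]
    positivity
  · have : (count a x reversedStep : ℤ) ≤ x + 1 := by
      rcases le_total a 0 with ha | ha
      · have h0 : count a x reversedStep = count 0 x reversedStep := by
          refine (Finset.sum_subset (Finset.Icc_subset_Icc_left ha) fun k hk hk' => ?_).symm
          rw [Finset.mem_Icc] at hk hk'
          simp [reversedStep]
          omega
        rw [h0]
        exact (count_le (by omega) _).trans (by omega)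
      · rcases le_total a (x + 1) with h | h
        · exact (count_le h _).trans (by omega)
        · rw [count_of_lt (by omega)]; simp; omega
    have h2 : expCount z a x reversedStep ≤ z ^ (x + 1) := by
      rw [expCount, ← zpow_natCast]
      exact zpow_le_zpow_right₀ hz this
    linarith

/-- In the bulk, the exponential of the particle number is a subsolution of the heat equation of
the walk that jumps to the right at rate `1 / (1 + z)` and to the left at rate `z / (1 + z)`; the
error term comes from the particles that enter the interval from the left. -/
lemma generator_expCount_le {p z : ℝ} (hp1 : p ≤ 1) (hz : 1 ≤ z)
    (hzp : (1 - p) * z ≤ p) {a x : ℤ} (h : a ≤ x) (η : Config) :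
    generator p (expCount z a x) η ≤
      1 / (1 + z) * expCount z a (x + 1) η + z / (1 + z) * expCount z a (x - 1) η
        - expCount z a x η + (z - 1) * z ^ (x - a) * occ (a - 1) η := by
  have hz0 : 0 < 1 + z := by linarith
  -- Only exchanges across the two ends of `[a, x]` change the count.
  rw [generator_eq_sum p {a - 1, x}, Finset.sum_pair (by omega)]
  · have hleft : rate p η (a - 1) * (expCount z a x (exchange η (a - 1)) - expCount z a x η) ≤
        (z - 1) * z ^ (x - a) * occ (a - 1) η := by
      have e1 : exchange η (a - 1) a = η (a - 1) := by simpa using exchange_right η (a - 1)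
      have e2 : count (a + 1) x (exchange η (a - 1)) = count (a + 1) x η :=
        count_exchange_outside (by omega) η
      have e3 : z ^ count (a + 1) x η ≤ z ^ (x - a) := by
        simpa [expCount] using expCount_le (a := a + 1) (x := x) hz (by omega) η
      have e4 : 1 ≤ z ^ count (a + 1) x η := one_le_pow₀ hz
      rw [expCount, expCount, count_eq_add_left h, count_eq_add_left h, e1, e2, pow_add, pow_add]
      simp only [rate, sub_add_cancel, occ]
      cases η (a - 1) <;> cases η a <;> simp
      · nlinarith [mul_nonneg (mul_nonneg (sub_nonneg.2 hp1) (sub_nonneg.2 hz))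
          (zero_le_one.trans e4)]
      · nlinarith [mul_nonneg (mul_nonneg (sub_nonneg.2 hp1) (sub_nonneg.2 hz))
          (zero_le_one.trans e4), mul_nonneg (sub_nonneg.2 hz) (sub_nonneg.2 e3)]
      · exact mul_nonneg (by linarith) (by linarith)
    have hright : rate p η x * (expCount z a x (exchange η x) - expCount z a x η) ≤
        1 / (1 + z) * expCount z a (x + 1) η + z / (1 + z) * expCount z a (x - 1) η
          - expCount z a x η := by
      have e2 : count a (x - 1) (exchange η x) = count a (x - 1) η :=
        count_exchange_outside (by omega) η
      have e4 : 1 ≤ z ^ count a (x - 1) η := one_le_pow₀ hz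
      have e5 : count a (x + 1) η = count a (x - 1) η + (η x).toNat + (η (x + 1)).toNat := by
        rw [count_eq_add_right (by omega), add_sub_cancel_right, count_eq_add_right h]
      unfold expCount
      rw [e5, count_eq_add_right h, count_eq_add_right h, e2, exchange_left]
      set w := z ^ count a (x - 1) η with hw
      have hβ : z / (1 + z) = 1 - 1 / (1 + z) := by field_simp; ring
      -- This is `(1 - p) * z ≤ p` rewritten. It settles the two cases where a particle can cross
      -- the bond; `hαz` gives equality when both sites are occupied.
      have hα : 1 - p ≤ 1 / (1 + z) := by rw [le_div_iff₀ hz0]; linarith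
      have hαz : 1 / (1 + z) * z = 1 - 1 / (1 + z) := by field_simp; ring
      rw [hβ]
      set α := 1 / (1 + z)
      simp only [rate, pow_add, ← hw]
      cases η x <;> cases η (x + 1) <;> simp
      · nlinarith
      · nlinarith [mul_nonneg (mul_nonneg (sub_nonneg.2 hα) (sub_nonneg.2 hz))
          (zero_le_one.trans e4)]
      · have : α * (w * z) + (1 - α) * w - w * z - p * (w - w * z)
            = (p - 1 + α) * (w * (z - 1)) := by ring
        nlinarith [mul_nonneg (mul_nonneg (sub_nonneg.2 hα) (sub_nonneg.2 hz))
          (zero_le_one.trans e4)]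
      · have : α * (w * z * z) + (1 - α) * w - w * z = 0 := by
          linear_combination (w * z - w) * hαz
        linarith
    linarith
  · intro j hj
    simp only [Finset.mem_insert, Finset.mem_singleton, not_or] at hj
    unfold expCount
    by_cases h1 : j < a - 1 ∨ x < j
    · rw [count_exchange_outside h1]
    · rw [count_exchange_inside] <;> omega

end Count

/-! ### Time evolution of expectations -/

section Evolution

variable {Ω : Type*} [MeasurableSpace Ω] {p : ℝ} {μ : Measure Ω} {η : ℝ≥0 → Ω → Config}
  {f : Config → ℝ}

lemma tendsto_floor_add_one_div (t : ℝ≥0) :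
    Tendsto (fun n : ℕ => ((⌊(n + 1 : ℝ≥0) * t⌋₊ + 1 : ℕ) : ℝ≥0) / (n + 1)) atTop (𝓝[≥] t) := by
  refine tendsto_nhdsWithin_iff.2 ⟨?_, Eventually.of_forall fun n => ?_⟩
  · refine tendsto_of_tendsto_of_tendsto_of_le_of_le (g := fun _ => t)
      (h := fun n : ℕ => t + 1 / ((n : ℝ≥0) + 1)) tendsto_const_nhds ?_ ?_ ?_
    · simpa using (tendsto_one_div_add_atTop_nhds_zero_nat (𝕜 := ℝ≥0)).const_add t
    · intro n
      dsimp only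
      rw [le_div_iff₀ (by positivity), mul_comm]
      push_cast
      exact (Nat.lt_floor_add_one _).le
    · intro n
      dsimp only
      have h0 : (n + 1 : ℝ≥0) ≠ 0 := by positivity
      rw [div_le_iff₀ (by positivity), add_mul t, one_div, inv_mul_cancel₀ h0, mul_comm t]
      push_cast
      gcongr
      exact Nat.floor_le zero_le
  · rw [Set.mem_Ici, le_div_iff₀ (by positivity), mul_comm]
    push_cast
    exact (Nat.lt_floor_add_one _).le

/-- Right continuity makes the process a pointwise limit of its values at grid times approaching
from the right. Joint measurability is what Fubini needs. -/
lemma IsASEP.measurable_uncurry (h : IsASEP p μ η) (hf : IsCylinder f) :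
    Measurable (Function.uncurry fun (s : ℝ) ω => f (η s.toNNReal ω)) := by
  refine measurable_of_tendsto_metrizable (f := fun (n : ℕ) (q : ℝ × Ω) =>
    f (η (((⌊(n + 1 : ℝ≥0) * q.1.toNNReal⌋₊ + 1 : ℕ) : ℝ≥0) / (n + 1)) q.2)) (fun n => ?_) ?_
  · have h1 : Measurable fun r : ℕ × Ω => f (η (((r.1 + 1 : ℕ) : ℝ≥0) / (n + 1)) r.2) :=
      measurable_from_prod_countable_right fun k =>
        hf.measurable.comp (h.measurable (((k + 1 : ℕ) : ℝ≥0) / (n + 1)))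
    have h2 : Measurable fun q : ℝ × Ω => (⌊(n + 1 : ℝ≥0) * q.1.toNNReal⌋₊, q.2) :=
      (Nat.measurable_floor.comp
        ((measurable_fst.real_toNNReal).const_mul _)).prodMk measurable_snd
    exact h1.comp h2
  · refine tendsto_pi_nhds.2 fun q => ?_
    exact (hf.continuous.tendsto _).comp
      ((h.right_continuous q.2 q.1.toNNReal).tendsto.comp (tendsto_floor_add_one_div _))

/-- The expectation of an observable at time `t`. -/
def mean (μ : Measure Ω) (η : ℝ≥0 → Ω → Config) (f : Config → ℝ) (t : ℝ) : ℝ :=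
  ∫ ω, f (η t.toNNReal ω) ∂μ

lemma IsASEP.integrable [IsFiniteMeasure μ] (h : IsASEP p μ η) (hf : IsCylinder f) (t : ℝ≥0) :
    Integrable (fun ω => f (η t ω)) μ := by
  obtain ⟨C, hC⟩ := hf.exists_bound
  exact Integrable.of_bound (hf.measurable.comp (h.measurable t)).aestronglyMeasurable C
    (Eventually.of_forall fun ω => hC _)

instance isFiniteMeasure_restrict_uIoc (a b : ℝ) :
    IsFiniteMeasure (volume.restrict (Set.uIoc a b)) := by
  unfold Set.uIoc; infer_instance

lemma IsASEP.integrable_prod [IsFiniteMeasure μ] (h : IsASEP p μ η) (hf : IsCylinder f) (t : ℝ) :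
    Integrable (Function.uncurry fun (s : ℝ) ω => f (η s.toNNReal ω))
      ((volume.restrict (Set.uIoc 0 t)).prod μ) := by
  obtain ⟨C, hC⟩ := hf.exists_bound
  exact Integrable.of_bound (h.measurable_uncurry hf).aestronglyMeasurable C
    (Eventually.of_forall fun q => hC _)

lemma IsASEP.intervalIntegrable (h : IsASEP p μ η) (hf : IsCylinder f)
    (ω : Ω) (a b : ℝ) :
    IntervalIntegrable (fun s : ℝ => f (η s.toNNReal ω)) volume a b := by
  obtain ⟨C, hC⟩ := hf.exists_bound
  rw [intervalIntegrable_iff]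
  exact Integrable.of_bound
    ((h.measurable_uncurry hf).comp (measurable_id.prodMk measurable_const)).aestronglyMeasurable C
    (Eventually.of_forall fun s => hC _)

lemma IsASEP.integrable_integral [IsFiniteMeasure μ] (h : IsASEP p μ η) (hf : IsCylinder f)
    (t : ℝ) : Integrable (fun ω => ∫ s in (0 : ℝ)..t, f (η s.toNNReal ω)) μ := by
  simp_rw [intervalIntegral.intervalIntegral_eq_integral_uIoc]
  exact (h.integrable_prod hf t).integral_prod_right.smul (if (0 : ℝ) ≤ t then (1 : ℝ) else -1)

lemma IsASEP.integral_integral [IsFiniteMeasure μ] (h : IsASEP p μ η) (hf : IsCylinder f)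
    (t : ℝ) :
    ∫ ω, (∫ s in (0 : ℝ)..t, f (η s.toNNReal ω)) ∂μ = ∫ s in (0 : ℝ)..t, mean μ η f s :=
  (intervalIntegral_integral_swap (h.integrable_prod hf t)).symm

lemma IsASEP.intervalIntegrable_mean [IsFiniteMeasure μ] (h : IsASEP p μ η) (hf : IsCylinder f)
    (a b : ℝ) : IntervalIntegrable (mean μ η f) volume a b := by
  obtain ⟨C, hC⟩ := hf.exists_bound
  rw [intervalIntegrable_iff]
  refine Integrable.of_bound (C := C * μ.real Set.univ) ?_ (Eventually.of_forall fun s => ?_)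
  · exact ((h.measurable_uncurry hf).stronglyMeasurable.integral_prod_right).aestronglyMeasurable
  · exact norm_integral_le_of_norm_le_const (Eventually.of_forall fun ω => hC _)

/-- The Dynkin martingale has constant expectation, and Fubini moves the expectation inside the time
integral. -/
lemma IsASEP.mean_eq [IsFiniteMeasure μ] (h : IsASEP p μ η) (hf : IsCylinder f) {t : ℝ}
    (ht : 0 ≤ t) : mean μ η f t = mean μ η f 0 + ∫ s in (0 : ℝ)..t, mean μ η (generator p f) s := by
  have h1 := (h.martingale f hf).setIntegral_eq (zero_le : 0 ≤ t.toNNReal) MeasurableSet.univ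
  simp only [Measure.restrict_univ, NNReal.coe_zero, intervalIntegral.integral_same, sub_zero,
    Real.coe_toNNReal t ht] at h1
  rw [integral_sub (h.integrable hf _) (h.integrable_integral (hf.generator p) t),
    h.integral_integral (hf.generator p)] at h1
  simp only [mean, Real.toNNReal_zero] at h1 ⊢
  linarith

lemma IsASEP.continuousOn_mean [IsFiniteMeasure μ] (h : IsASEP p μ η) (hf : IsCylinder f) :
    ContinuousOn (mean μ η f) (Set.Ici 0) :=
  (continuous_const.add (intervalIntegral.continuous_primitive
    (h.intervalIntegrable_mean (hf.generator p)) 0)).continuousOn.congr fun _ ht => h.mean_eq hf ht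

lemma IsASEP.hasDerivAt_mean [IsFiniteMeasure μ] (h : IsASEP p μ η) (hf : IsCylinder f) {t : ℝ}
    (ht : 0 < t) : HasDerivAt (mean μ η f) (mean μ η (generator p f) t) t := by
  have hc := (h.continuousOn_mean (hf.generator p)).mono Set.Ioi_subset_Ici_self
  have h1 := (intervalIntegral.integral_hasDerivAt_right
    (h.intervalIntegrable_mean (hf.generator p) 0 t)
    (hc.stronglyMeasurableAtFilter isOpen_Ioi t ht)
    (hc.continuousAt (Ioi_mem_nhds ht))).const_add (mean μ η f 0)
  refine h1.congr_of_eventuallyEq ?_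
  filter_upwards [Ioi_mem_nhds ht] with s hs using h.mean_eq hf (le_of_lt hs)

lemma IsASEP.mean_mono [IsFiniteMeasure μ] (h : IsASEP p μ η) {g : Config → ℝ}
    (hf : IsCylinder f) (hg : IsCylinder g) (hfg : ∀ ξ, f ξ ≤ g ξ) (t : ℝ) :
    mean μ η f t ≤ mean μ η g t :=
  integral_mono (h.integrable hf _) (h.integrable hg _) fun _ => hfg _

end Evolution

/-! ### Comparison principle for the heat equation -/

section Comparison

lemma le_pow_div_factorial_of_hasDerivAt {f f' : ℝ → ℝ} {T C : ℝ} {n : ℕ}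
    (hf : ContinuousOn f (Set.Icc 0 T)) (hf' : ∀ t ∈ Set.Ioo 0 T, HasDerivAt f (f' t) t)
    (hle : ∀ t ∈ Set.Ioo 0 T, f' t ≤ C * (t ^ n / n.factorial)) (h0 : f 0 ≤ 0)
    {t : ℝ} (ht : t ∈ Set.Icc 0 T) : f t ≤ C * (t ^ (n + 1) / (n + 1).factorial) := by
  have hd : ∀ s ∈ Set.Ioo 0 T,
      HasDerivAt (fun s => f s - C * (s ^ (n + 1) / (n + 1).factorial))
        (f' s - C * (s ^ n / n.factorial)) s := by
    intro s hs
    have h1 := (hf' s hs).fun_sub (((hasDerivAt_pow (n + 1) s).div_const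
      ((n + 1).factorial : ℝ)).const_mul C)
    refine h1.congr_deriv ?_
    rw [Nat.factorial_succ]
    have : (n.factorial : ℝ) ≠ 0 := by positivity
    push_cast
    field_simp
  have hanti := antitoneOn_of_deriv_nonpos (convex_Icc 0 T)
    (f := fun s => f s - C * (s ^ (n + 1) / (n + 1).factorial))
    (hf.sub (by fun_prop)) (fun s hs => by
      rw [interior_Icc] at hs
      exact (hd s hs).differentiableAt.differentiableWithinAt) (fun s hs => by
      rw [interior_Icc] at hs
      rw [(hd s hs).deriv]
      linarith [hle s hs])
  have := hanti (Set.left_mem_Icc.2 (ht.1.trans ht.2)) ht ht.1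
  simp at this
  linarith

/-- Comparison with zero for subsolutions, of at most exponential growth, of the heat equation of
an asymmetric simple random walk on `ℤ`. -/
lemma nonpos_of_heat_subsolution {d d' : ℤ → ℝ → ℝ} {a : ℤ} {α β z B T : ℝ} (hα : 0 ≤ α)
    (hβ : 0 ≤ β) (hz : 0 < z) (hαβ : α * z + β / z = 1) (hB : 0 ≤ B)
    (hd : ∀ x, ContinuousOn (d x) (Set.Icc 0 T))
    (hd' : ∀ x ≥ a, ∀ t ∈ Set.Ioo 0 T, HasDerivAt (d x) (d' x t) t)
    (hle : ∀ x ≥ a, ∀ t ∈ Set.Ioo 0 T,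
      d' x t ≤ α * d (x + 1) t + β * d (x - 1) t - d x t)
    (h0 : ∀ x, d x 0 ≤ 0) (hlt : ∀ x < a, ∀ t ∈ Set.Icc 0 T, d x t ≤ 0)
    (hbound : ∀ x, ∀ t ∈ Set.Icc 0 T, d x t ≤ B * z ^ x) (x : ℤ) {t : ℝ}
    (ht : t ∈ Set.Icc 0 T) : d x t ≤ 0 := by
  -- The factor `exp t` removes the term `-d x t`. Each integration in time then gains a factor of
  -- the exponential series, whose terms tend to zero.
  have key : ∀ n : ℕ, ∀ x : ℤ, ∀ t ∈ Set.Icc 0 T,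
      Real.exp t * d x t ≤ (Real.exp T * B * z ^ x) * (t ^ n / n.factorial) := by
    intro n
    induction n with
    | zero =>
      intro x t ht
      simp only [pow_zero, Nat.factorial_zero, Nat.cast_one, div_one, mul_one]
      calc Real.exp t * d x t ≤ Real.exp t * (B * z ^ x) := by gcongr; exact hbound x t ht
        _ ≤ Real.exp T * (B * z ^ x) := by gcongr; exact ht.2
        _ = _ := by ring
    | succ n ih =>
      intro x t ht
      rcases lt_or_ge x a with hx | hx
      · refine (mul_nonpos_of_nonneg_of_nonpos (Real.exp_nonneg t) (hlt x hx t ht)).trans ?_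
        have := ht.1
        positivity
      refine le_pow_div_factorial_of_hasDerivAt (f := fun t => Real.exp t * d x t)
        (f' := fun t => Real.exp t * d x t + Real.exp t * d' x t)
        (Real.continuous_exp.continuousOn.mul (hd x))
        (fun s hs => (Real.hasDerivAt_exp s).mul (hd' x hx s hs)) (fun s hs => ?_) ?_ ht
      · have hs' := Set.Ioo_subset_Icc_self hs
        have e1 := mul_le_mul_of_nonneg_left (ih (x + 1) s hs') hα
        have e2 := mul_le_mul_of_nonneg_left (ih (x - 1) s hs') hβ
        have e3 := mul_le_mul_of_nonneg_left (hle x hx s hs) (Real.exp_nonneg s)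
        rw [zpow_add_one₀ hz.ne'] at e1
        rw [zpow_sub_one₀ hz.ne'] at e2
        -- By `hαβ`, the profile `z ^ x` is harmonic for the walk, so the induction reproduces it
        -- with the same constant.
        have e4 : Real.exp T * B * z ^ x * (s ^ n / n.factorial) =
            α * (Real.exp T * B * (z ^ x * z) * (s ^ n / n.factorial)) +
            β * (Real.exp T * B * (z ^ x * z⁻¹) * (s ^ n / n.factorial)) := by
          rw [div_eq_mul_inv] at hαβ
          linear_combination (-(Real.exp T * B * z ^ x * (s ^ n / n.factorial))) * hαβ
        rw [e4]
        linarith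
      · simpa using h0 x
  have hlim : Tendsto (fun n : ℕ => (Real.exp T * B * z ^ x) * (t ^ n / n.factorial)) atTop
      (𝓝 ((Real.exp T * B * z ^ x) * 0)) :=
    (FloorSemiring.tendsto_pow_div_factorial_atTop t).const_mul _
  rw [mul_zero] at hlim
  have := ge_of_tendsto' hlim fun n => key n x t ht
  exact nonpos_of_mul_nonpos_right this (Real.exp_pos t)

end Comparison

/-! ### Density bounds -/

section Density

variable {Ω : Type*} [MeasurableSpace Ω] {p : ℝ} {μ : Measure Ω} {η : ℝ≥0 → Ω → Config}

lemma mean_zero_of_ae [IsProbabilityMeasure μ] (h0 : ∀ᵐ ω ∂μ, η 0 ω = reversedStep)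
    (f : Config → ℝ) : mean μ η f 0 = f reversedStep := by
  have : (fun ω => f (η (0 : ℝ).toNNReal ω)) =ᵐ[μ] fun _ => f reversedStep := by
    filter_upwards [h0] with ω hω
    rw [Real.toNNReal_zero, hω]
  rw [mean, integral_congr_ae this]
  simp

lemma mean_le [IsProbabilityMeasure μ] (h : IsASEP p μ η) {f : Config → ℝ} (hf : IsCylinder f)
    {C : ℝ} (hC : ∀ ξ, f ξ ≤ C) (t : ℝ) : mean μ η f t ≤ C := by
  have := integral_mono (h.integrable hf t.toNNReal) (integrable_const (μ := μ) C) fun ω => hC _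
  simpa [mean] using this

lemma mean_linear [IsFiniteMeasure μ] (h : IsASEP p μ η) {f g : Config → ℝ} (hf : IsCylinder f)
    (hg : IsCylinder g) (a b : ℝ) (t : ℝ) :
    mean μ η (fun ξ => a * f ξ + b * g ξ) t = a * mean μ η f t + b * mean μ η g t := by
  unfold mean
  rw [integral_add ((h.integrable hf _).const_mul a) ((h.integrable hg _).const_mul b),
    integral_const_mul, integral_const_mul]

lemma IsCylinder.linear {f g : Config → ℝ} (hf : IsCylinder f) (hg : IsCylinder g) (a b : ℝ) :
    IsCylinder fun ξ => a * f ξ + b * g ξ := by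
  obtain ⟨S, hS⟩ := hf
  obtain ⟨T, hT⟩ := hg
  refine ⟨S ∪ T, fun x y hxy => ?_⟩
  simp only
  rw [hS fun i hi => hxy i (by simp_all), hT fun i hi => hxy i (by simp_all)]

/-- Finite propagation speed: the density at distance `n` to the left of the initial particles. -/
lemma IsASEP.mean_occ_le_pow_div_factorial [IsProbabilityMeasure μ] (h : IsASEP p μ η)
    (h0 : ∀ᵐ ω ∂μ, η 0 ω = reversedStep) (hp : 0 ≤ p) (hp1 : p ≤ 1) (n : ℕ) {i : ℤ}
    (hi : i ≤ -n) {t : ℝ} (ht : 0 ≤ t) : mean μ η (occ i) t ≤ t ^ n / n.factorial := by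
  induction n generalizing i t with
  | zero => simpa using mean_le h (isCylinder_occ i) (occ_le_one i) t
  | succ n ih =>
    push_cast at hi
    rw [← one_mul (_ / _)]
    refine le_pow_div_factorial_of_hasDerivAt (T := t)
      ((h.continuousOn_mean (isCylinder_occ i)).mono Set.Icc_subset_Ici_self)
      (fun s hs => h.hasDerivAt_mean (isCylinder_occ i) hs.1) (fun s hs => ?_) ?_ ⟨ht, le_rfl⟩
    · have h1 := h.mean_mono ((isCylinder_occ i).generator p)
        ((isCylinder_occ (i - 1)).linear (isCylinder_occ (i + 1)) p (1 - p))
        (generator_occ_le hp hp1 i) s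
      rw [mean_linear h (isCylinder_occ _) (isCylinder_occ _)] at h1
      have h2 := mul_le_mul_of_nonneg_left (ih (i := i - 1) (by omega) hs.1.le) hp
      have h3 := mul_le_mul_of_nonneg_left (ih (i := i + 1) (by omega) hs.1.le) (sub_nonneg.2 hp1)
      linarith
    · rw [mean_zero_of_ae h0]
      have : ¬ 0 ≤ i := by omega
      simp [occ, reversedStep, this]

/-- The density at `x` is at most the one of the reversible blocking measure, up to a constant. -/
lemma IsASEP.mean_occ_le [IsProbabilityMeasure μ] (h : IsASEP p μ η)
    (h0 : ∀ᵐ ω ∂μ, η 0 ω = reversedStep) (hp : 0 ≤ p) (hp1 : p ≤ 1) {z : ℝ} (hz : 1 < z)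
    (hzp : (1 - p) * z ≤ p) (x : ℤ) {t : ℝ} (ht : 0 ≤ t) :
    (z - 1) * mean μ η (occ x) t ≤ z ^ (x + 1) := by
  have hz0 : 0 < z := by linarith
  -- `κ n * z ^ (y - 1)` bounds the error from particles entering `[1 - n, y]` at its left end.
  set κ : ℕ → ℝ := fun n => (z - 1) * z ^ n * (t ^ n / n.factorial) with hκ
  have hκ0 : ∀ n, 0 ≤ κ n := fun n => by
    have : 0 ≤ z - 1 := by linarith
    positivity
  have key : ∀ n : ℕ, ∀ y : ℤ, ∀ s ∈ Set.Icc 0 t,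
      mean μ η (expCount z (1 - n) y) s - 1 - z ^ (y + 1) - κ n * z ^ (y - 1) * s ≤ 0 := by
    intro n
    have hc : ∀ y, IsCylinder (expCount z (1 - n) y) := isCylinder_expCount z _
    have hlt : ∀ y : ℤ, y < 1 - n → ∀ s, mean μ η (expCount z (1 - n) y) s = 1 := by
      intro y hy s
      simp [mean, expCount, count_of_lt hy]
    intro y s hs
    refine nonpos_of_heat_subsolution (z := z) (a := 1 - n)
      (d := fun y s => mean μ η (expCount z (1 - n) y) s - 1 - z ^ (y + 1) - κ n * z ^ (y - 1) * s)
      (d' := fun y s => mean μ η (generator p (expCount z (1 - n) y)) s - κ n * z ^ (y - 1))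
      (B := z ^ n) (T := t) (α := 1 / (1 + z)) (β := z / (1 + z)) (by positivity) (by positivity)
      hz0 (by field_simp; ring) (by positivity) (fun y => ?_) (fun y _ s hs => ?_)
      (fun y hy s hs => ?_) (fun y => ?_) (fun y hy s hs => ?_) (fun y s hs => ?_) y hs
    · exact ((((h.continuousOn_mean (hc y)).mono Set.Icc_subset_Ici_self).sub
        continuousOn_const).sub continuousOn_const).sub (by fun_prop)
    · have := (((h.hasDerivAt_mean (hc y) hs.1).sub_const 1).sub_const (z ^ (y + 1))).fun_sub
        ((hasDerivAt_id s).const_mul (κ n * z ^ (y - 1)))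
      simpa using this
    · have h1 := h.mean_mono ((hc y).generator p)
        (((((hc (y + 1)).linear (hc (y - 1)) (1 / (1 + z)) (z / (1 + z))).linear (hc y) 1 (-1))).linear
          (isCylinder_occ (1 - n - 1)) 1 ((z - 1) * z ^ (y - (1 - n))))
        (fun ξ => by
          have := generator_expCount_le hp1 hz.le hzp hy ξ
          linarith) s
      rw [mean_linear h (((hc (y + 1)).linear (hc (y - 1)) _ _).linear (hc y) 1 (-1))
          (isCylinder_occ _),
        mean_linear h ((hc (y + 1)).linear (hc (y - 1)) _ _) (hc y),
        mean_linear h (hc (y + 1)) (hc (y - 1))] at h1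
      have h2 : mean μ η (occ (1 - n - 1)) s ≤ t ^ n / n.factorial := by
        refine (h.mean_occ_le_pow_div_factorial h0 hp hp1 n (by omega) hs.1.le).trans ?_
        have := hs.1.le
        have := hs.2.le
        gcongr
      have h3 : (z - 1) * z ^ (y - (1 - n)) * mean μ η (occ (1 - n - 1)) s ≤
          κ n * z ^ (y - 1) := by
        have e : z ^ (y - (1 - n) : ℤ) = z ^ n * z ^ (y - 1) := by
          rw [← zpow_natCast, ← zpow_add₀ hz0.ne']; congr 1; ring
        rw [e]
        have h4 : 0 ≤ (z - 1) * (z ^ n * z ^ (y - 1)) := by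
          have : 0 ≤ z - 1 := by linarith
          positivity
        have := mul_le_mul_of_nonneg_left h2 h4
        simp only [hκ]
        linarith
      have e1 : z ^ (y + 1 + 1) = z ^ y * z * z := by rw [zpow_add_one₀ hz0.ne', zpow_add_one₀ hz0.ne']
      have e2 : z ^ (y - 1 + 1) = z ^ y := by rw [sub_add_cancel]
      have e3 : z ^ (y - 1) = z ^ y / z := by rw [zpow_sub_one₀ hz0.ne', div_eq_mul_inv]
      have e4 : z ^ (y - 1 - 1) = z ^ y / z / z := by
        rw [zpow_sub_one₀ hz0.ne', e3, div_eq_mul_inv (_ / z)]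
      have e5 : z ^ (y + 1 - 1) = z ^ y := by rw [add_sub_cancel_right]
      have e6 : z ^ (y + 1) = z ^ y * z := zpow_add_one₀ hz0.ne' y
      -- All three correction terms are harmonic in `y`; the time derivative of the last one absorbs
      -- the boundary error.
      have e7 : 1 / (1 + z) * (1 + z ^ y * z * z + κ n * z ^ y * s) +
          z / (1 + z) * (1 + z ^ y + κ n * (z ^ y / z / z) * s) =
          1 + z ^ y * z + κ n * (z ^ y / z) * s := by
        field_simp
        ring
      simp only [e1, e2, e3, e4, e5, e6] at h3 ⊢
      linarith
    · simp only [mean_zero_of_ae h0, mul_zero, sub_zero]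
      linarith [expCount_reversedStep_le hz.le (1 - n) y]
    · have := hκ0 n
      have := hs.1
      have : 0 ≤ z ^ (y + 1) + κ n * z ^ (y - 1) * s := by positivity
      simp only [hlt y hy]
      linarith
    · have h2 : 0 ≤ z ^ (y + 1) + κ n * z ^ (y - 1) * s := by
        have := hκ0 n
        have := hs.1
        positivity
      -- The window has `y + n` sites, which gives the a priori growth bound with `B = z ^ n`.
      have h3 : mean μ η (expCount z (1 - n) y) s - 1 ≤ z ^ n * z ^ y := by
        rcases lt_or_ge y (1 - n) with hy | hy
        · rw [hlt y hy, sub_self]; positivity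
        · have := mean_le h (hc y) (expCount_le hz.le (by omega)) s
          have e : z ^ (y + 1 - (1 - n) : ℤ) = z ^ n * z ^ y := by
            rw [← zpow_natCast, ← zpow_add₀ hz0.ne']; congr 1; ring
          linarith
      linarith
  have hlim : Tendsto (fun n => z ^ (x + 1) + κ n * z ^ (x - 1) * t) atTop
      (𝓝 (z ^ (x + 1) + ((z - 1) * 0) * z ^ (x - 1) * t)) := by
    refine (((Tendsto.const_mul (z - 1)
      (FloorSemiring.tendsto_pow_div_factorial_atTop (z * t))).mul_const _).mul_const _).const_add _
      |>.congr fun n => ?_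
    simp only [hκ]
    rw [mul_pow]
    ring
  simp only [mul_zero, zero_mul, add_zero] at hlim
  refine ge_of_tendsto hlim ?_
  -- For such `n` the window `[1 - n, x]` contains `x`, so the count sees the particle there.
  filter_upwards [eventually_ge_atTop (1 - x).toNat] with n hn
  have h1 := key n x t ⟨ht, le_rfl⟩
  have h2 := h.mean_mono ((isCylinder_occ x).linear (isCylinder_occ x) (z - 1) 0)
    ((isCylinder_expCount z (1 - n) x).linear (g := fun _ => 1) ⟨∅, fun _ _ _ => rfl⟩ 1 (-1))
    (fun ξ => by
      have := occ_le_expCount hz.le (a := 1 - n) (x := x) (by omega) ξ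
      linarith) t
  rw [mean_linear h (isCylinder_occ x) (isCylinder_occ x),
    mean_linear h (isCylinder_expCount z (1 - n) x) ⟨∅, fun _ _ _ => rfl⟩] at h2
  have h3 : mean μ η (fun _ => 1) t = 1 := by simp [mean]
  rw [h3] at h2
  linarith

end Density

/-! ### From fixed times to the whole time interval -/

section Maximal

/-- A maximal inequality: if `M` is a martingale and `M + H` is at least one at the time when the
events `B` first occur, and nonnegative at the terminal time, then the expectation of `M + H` at
the terminal time bounds the probability that one of the events occurs. -/
lemma measureReal_biUnion_le_of_martingale {Ω ι : Type*} [LinearOrder ι] {m : MeasurableSpace Ω}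
    {μ : Measure Ω} [IsFiniteMeasure μ] {ℱ : Filtration ι m} {M : ι → Ω → ℝ}
    (hM : Martingale M ℱ μ) {H : Ω → ℝ} (hH : Integrable H μ) {T : ι} (S : Finset ι)
    (hS : ∀ s ∈ S, s ≤ T) {B : ι → Set Ω} (hB : ∀ s, MeasurableSet[ℱ s] (B s))
    (hBM : ∀ s ∈ S, ∀ ω ∈ B s, 1 ≤ M s ω + H ω) (h0 : ∀ ω, 0 ≤ M T ω + H ω) :
    μ.real (⋃ s ∈ S, B s) ≤ ∫ ω, (M T ω + H ω) ∂μ := by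
  -- Split according to the first time in `S` at which an event occurs. `H` need not be adapted:
  -- only the martingale part changes time on `A s`.
  let A : ι → Set Ω := fun s => B s \ ⋃ r ∈ S.filter (· < s), B r
  have hA : ∀ s, MeasurableSet[ℱ s] (A s) := fun s =>
    (hB s).diff (Finset.measurableSet_biUnion _ fun r hr =>
      ℱ.mono (Finset.mem_filter.1 hr).2.le _ (hB r))
  have hA' : ∀ s, MeasurableSet (A s) := fun s => ℱ.le s _ (hA s)
  have hdisj : (S : Set ι).Pairwise (Function.onFun Disjoint A) := by
    have aux : ∀ r ∈ S, ∀ s, r < s → Disjoint (A r) (A s) := fun r hr s hrs =>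
      Set.disjoint_left.2 fun ω hω hω' =>
        hω'.2 (Set.mem_biUnion (x := r) (Finset.mem_filter.2 ⟨hr, hrs⟩) hω.1)
    intro r hr s hs hne
    rcases lt_or_gt_of_ne hne with hlt | hlt
    · exact aux r hr s hlt
    · exact (aux s hs r hlt).symm
  have hunion : (⋃ s ∈ S, B s) = ⋃ s ∈ S, A s := by
    refine Set.Subset.antisymm (fun ω hω => ?_)
      (Set.iUnion₂_mono fun s _ => Set.sdiff_subset)
    classical
    simp only [Set.mem_iUnion, exists_prop] at hω
    obtain ⟨s, hs, hmin⟩ := Finset.exists_min_image (S.filter fun s => ω ∈ B s) id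
      (by obtain ⟨s, hs⟩ := hω; exact ⟨s, by simpa using hs⟩)
    rw [Finset.mem_filter] at hs
    refine Set.mem_biUnion (x := s) hs.1 ⟨hs.2, fun hω' => ?_⟩
    simp only [Set.mem_iUnion, exists_prop, Finset.mem_filter] at hω'
    obtain ⟨r, ⟨hr, hrs⟩, hωr⟩ := hω'
    exact absurd (hmin r (Finset.mem_filter.2 ⟨hr, hωr⟩)) (not_le.2 hrs)
  have hint : ∀ s, Integrable (fun ω => M s ω + H ω) μ := fun s => (hM.integrable s).add hH
  calc μ.real (⋃ s ∈ S, B s) = ∑ s ∈ S, μ.real (A s) := by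
        rw [hunion, measureReal_biUnion_finset hdisj fun s _ => hA' s]
    _ ≤ ∑ s ∈ S, ∫ ω in A s, (M T ω + H ω) ∂μ := by
        refine Finset.sum_le_sum fun s hs => ?_
        rw [integral_add (hM.integrable T).integrableOn hH.integrableOn,
          ← hM.setIntegral_eq (hS s hs) (hA s),
          ← integral_add (hM.integrable s).integrableOn hH.integrableOn]
        have := setIntegral_mono_on (integrableOn_const (μ := μ) (s := A s) (C := (1 : ℝ)))
          (hint s).integrableOn (hA' s) fun ω hω => hBM s hs ω hω.1
        simpa using this
    _ = ∫ ω in ⋃ s ∈ S, A s, (M T ω + H ω) ∂μ :=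
        (integral_biUnion_finset S (fun s _ => hA' s) hdisj fun s _ => (hint T).integrableOn).symm
    _ ≤ ∫ ω, (M T ω + H ω) ∂μ :=
        setIntegral_le_integral (hint T) (Eventually.of_forall h0)

variable {Ω : Type*} [MeasurableSpace Ω] {p : ℝ} {μ : Measure Ω} {η : ℝ≥0 → Ω → Config}

/-- A bound on the probability that a given site to the left of the origin becomes occupied. -/
lemma IsASEP.measureReal_exists_occupied_le [IsProbabilityMeasure μ] (h : IsASEP p μ η)
    (h0 : ∀ᵐ ω ∂μ, η 0 ω = reversedStep) (hp : 0 ≤ p) (hp1 : p ≤ 1) {z : ℝ} (hz : 1 < z)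
    (hzp : (1 - p) * z ≤ p) {i : ℤ} (hi : i < 0) (t : ℝ≥0) :
    μ.real {ω | ∃ s ≤ t, η s ω i = true} ≤ t * (z ^ (i + 2) / (z - 1)) := by
  have hz1 : 0 < z - 1 := sub_pos.2 hz
  set f := occ i
  have hf : IsCylinder f := isCylinder_occ i
  set g : Config → ℝ := fun ξ => p * occ (i - 1) ξ + (1 - p) * occ (i + 1) ξ with hg_def
  have hg : IsCylinder g := (isCylinder_occ _).linear (isCylinder_occ _) _ _
  have hg0 : ∀ ξ, 0 ≤ g ξ := fun ξ =>
    add_nonneg (mul_nonneg hp (occ_nonneg _ _)) (mul_nonneg (sub_nonneg.2 hp1) (occ_nonneg _ _))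
  have hfg : ∀ ξ, generator p f ξ ≤ g ξ := generator_occ_le hp hp1 i
  have hLf := hf.generator p
  set M : ℝ≥0 → Ω → ℝ := fun t ω =>
    f (η t ω) - ∫ s in (0 : ℝ)..(t : ℝ), generator p f (η s.toNNReal ω) with hM_def
  have hM : Martingale M _ μ := h.martingale f hf
  set H : Ω → ℝ := fun ω => ∫ s in (0 : ℝ)..(t : ℝ), g (η s.toNNReal ω)
  have hH : Integrable H μ := h.integrable_integral hg t
  have hMH : ∀ s ≤ t, ∀ ω, f (η s ω) ≤ M s ω + H ω := by
    intro s hs ω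
    have e1 : ∫ r in (0 : ℝ)..(s : ℝ), generator p f (η r.toNNReal ω) ≤
        ∫ r in (0 : ℝ)..(s : ℝ), g (η r.toNNReal ω) :=
      intervalIntegral.integral_mono_on s.coe_nonneg (h.intervalIntegrable hLf ω _ _)
        (h.intervalIntegrable hg ω _ _) fun r _ => hfg _
    have e2 : ∫ r in (0 : ℝ)..(s : ℝ), g (η r.toNNReal ω) ≤ H ω :=
      intervalIntegral.integral_mono_interval le_rfl s.coe_nonneg (by exact_mod_cast hs)
        (Eventually.of_forall fun r => hg0 _) (h.intervalIntegrable hg ω _ _)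
    simp only [hM_def]
    linarith
  have hmean : ∫ ω, (M t ω + H ω) ∂μ ≤ t * (z ^ (i + 2) / (z - 1)) := by
    -- The martingale has mean zero because site `i < 0` starts empty almost surely.
    have e1 : ∫ ω, M t ω ∂μ = 0 := by
      have h1 := hM.setIntegral_eq (zero_le : 0 ≤ t) MeasurableSet.univ
      simp only [Measure.restrict_univ] at h1
      have h2 := mean_zero_of_ae h0 f
      simp only [mean, Real.toNNReal_zero] at h2
      rw [← h1]
      simp only [hM_def, NNReal.coe_zero, intervalIntegral.integral_same, sub_zero, h2]
      simp [f, occ, reversedStep, not_le.2 hi]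
    have e2 : ∫ ω, H ω ∂μ = ∫ s in (0 : ℝ)..t, mean μ η g s := h.integral_integral hg t
    have e3 : ∫ s in (0 : ℝ)..t, mean μ η g s ≤ ∫ s in (0 : ℝ)..t, z ^ (i + 2) / (z - 1) := by
      refine intervalIntegral.integral_mono_on t.coe_nonneg (h.intervalIntegrable_mean hg _ _)
        intervalIntegrable_const fun s hs => ?_
      have h1 := h.mean_occ_le h0 hp hp1 hz hzp (i - 1) hs.1
      have h2 := h.mean_occ_le h0 hp hp1 hz hzp (i + 1) hs.1
      have h3 : z ^ (i - 1 + 1) ≤ z ^ (i + 2) := zpow_le_zpow_right₀ hz.le (by omega)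
      rw [add_assoc] at h2
      rw [le_div_iff₀ hz1, hg_def, mean_linear h (isCylinder_occ _) (isCylinder_occ _)]
      have h4 := mul_le_mul_of_nonneg_left (h1.trans h3) hp
      have h5 := mul_le_mul_of_nonneg_left h2 (sub_nonneg.2 hp1)
      norm_num at h5
      linarith
    rw [integral_add (hM.integrable t) hH, e1, e2, zero_add]
    refine e3.trans_eq ?_
    rw [intervalIntegral.integral_const, sub_zero, smul_eq_mul]
  have hη := fun t => (h.measurable t).stronglyMeasurable
  have hmeas : ∀ s, MeasurableSet[Filtration.natural η hη s] {ω | η s ω i = true} := by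
    intro s
    have h1 : Measurable[Filtration.natural η hη s] (η s) :=
      (Filtration.stronglyAdapted_natural hη s).measurable
    exact ((measurable_pi_apply i).comp h1) (measurableSet_singleton true)
  have hfin : ∀ S : Finset ℝ≥0, (∀ s ∈ S, s ≤ t) →
      μ.real (⋃ s ∈ S, {ω | η s ω i = true}) ≤ t * (z ^ (i + 2) / (z - 1)) := fun S hS =>
    (measureReal_biUnion_le_of_martingale hM hH S hS hmeas
      (fun s hs ω hω => le_trans (by simp only [Set.mem_ofPred_eq] at hω; simp [f, occ, hω])
        (hMH s (hS s hs) ω))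
      (fun ω => (occ_nonneg _ _).trans (hMH t le_rfl ω))).trans hmean
  obtain ⟨Q, hQc, hQd⟩ := TopologicalSpace.exists_countable_dense ℝ≥0
  -- Right continuity finds a time of `Q` after any visit before `t`; a visit exactly at `t`
  -- requires adding `t` itself.
  obtain ⟨q, hq⟩ := (hQc.insert t).exists_eq_range (Set.insert_nonempty _ _)
  let U : ℕ → Set Ω := fun n => ⋃ s ∈ ((Finset.range n).image q).filter (· ≤ t), {ω | η s ω i = true}
  have hUmono : Monotone U := fun m n hmn =>
    Set.biUnion_subset_biUnion_left fun s hs => by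
      simp only [Finset.coe_filter, Finset.mem_image, Finset.mem_range, Set.mem_ofPred_eq] at hs ⊢
      obtain ⟨⟨k, hk, hks⟩, hst⟩ := hs
      exact ⟨⟨k, hk.trans_le hmn, hks⟩, hst⟩
  have hsub : {ω | ∃ s ≤ t, η s ω i = true} ⊆ ⋃ n, U n := by
    rintro ω ⟨s, hst, hs⟩
    have : ∃ r ∈ insert t Q, r ≤ t ∧ η r ω i = true := by
      rcases hst.eq_or_lt with rfl | hlt
      · exact ⟨s, Set.mem_insert _ _, le_rfl, hs⟩
      · have hev : ∀ᶠ r in 𝓝[≥] s, η r ω i = true := by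
          have h1 : Tendsto (fun r => η r ω i) (𝓝[≥] s) (𝓝 (η s ω i)) :=
            ((continuous_apply i).tendsto _).comp (h.right_continuous ω s)
          rw [hs] at h1
          exact h1 (show {true} ∈ 𝓝 true by simp)
        obtain ⟨u, hu, hIco⟩ := (mem_nhdsGE_iff_exists_Ico_subset' hlt).1 hev
        obtain ⟨r, hrQ, hr⟩ := hQd.exists_between (lt_min hu hlt)
        exact ⟨r, Set.mem_insert_of_mem _ hrQ, (hr.2.trans_le (min_le_right _ _)).le,
          hIco ⟨hr.1.le, hr.2.trans_le (min_le_left _ _)⟩⟩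
    obtain ⟨r, hr, hrt, hrω⟩ := this
    rw [hq] at hr
    obtain ⟨k, rfl⟩ := hr
    refine Set.mem_iUnion.2 ⟨k + 1, Set.mem_biUnion (x := q k) ?_ hrω⟩
    simp only [Finset.coe_filter, Finset.mem_image, Finset.mem_range, Set.mem_ofPred_eq]
    exact ⟨⟨k, by omega, rfl⟩, hrt⟩
  have hlim : Tendsto (fun n => μ.real (U n)) atTop (𝓝 (μ.real (⋃ n, U n))) :=
    (ENNReal.tendsto_toReal (measure_ne_top _ _)).comp (tendsto_measure_iUnion_atTop hUmono)
  exact (measureReal_mono hsub).trans (le_of_tendsto' hlim fun n => hfin _ fun s hs =>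
    (Finset.mem_filter.1 hs).2)

/-- A bound on the probability that a site to the left of `-m` becomes occupied. -/
lemma IsASEP.measureReal_exists_occupied_lt_le [IsProbabilityMeasure μ] (h : IsASEP p μ η)
    (h0 : ∀ᵐ ω ∂μ, η 0 ω = reversedStep) (hp : 0 ≤ p) (hp1 : p ≤ 1) {z : ℝ} (hz : 1 < z)
    (hzp : (1 - p) * z ≤ p) (m : ℕ) (t : ℝ≥0) :
    μ.real {ω | ∃ s ≤ t, ∃ i : ℤ, i < -m ∧ η s ω i = true} ≤
      t * (z ^ 2 / (z - 1) ^ 2) * z⁻¹ ^ m := by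
  have hz1 : 0 < z - 1 := sub_pos.2 hz
  have hz0 : 0 < z := by linarith
  have hr0 : 0 ≤ z⁻¹ := by positivity
  have hr1 : z⁻¹ < 1 := inv_lt_one_of_one_lt₀ hz
  have hsum := (hasSum_geometric_of_lt_one hr0 hr1).mul_left
    (t * (z ^ 2 / (z - 1)) * z⁻¹ ^ (m + 1))
  have hsub : {ω | ∃ s ≤ t, ∃ i : ℤ, i < -m ∧ η s ω i = true} ⊆
      ⋃ k : ℕ, {ω | ∃ s ≤ t, η s ω (-(m + 1 + k : ℕ)) = true} := by
    rintro ω ⟨s, hs, i, hi, hω⟩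
    refine Set.mem_iUnion.2 ⟨(-(m + 1) - i).toNat, s, hs, ?_⟩
    convert hω using 2
    omega
  have hk : ∀ k : ℕ, μ {ω | ∃ s ≤ t, η s ω (-(m + 1 + k : ℕ)) = true} ≤
      ENNReal.ofReal (t * (z ^ 2 / (z - 1)) * z⁻¹ ^ (m + 1) * z⁻¹ ^ k) := by
    intro k
    rw [← ofReal_measureReal]
    refine ENNReal.ofReal_le_ofReal
      ((h.measureReal_exists_occupied_le h0 hp hp1 hz hzp (by omega) t).trans_eq ?_)
    rw [zpow_add₀ hz0.ne', zpow_neg, zpow_natCast, pow_add z (m + 1), inv_pow, inv_pow, mul_inv]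
    norm_cast
    ring
  have hle : μ {ω | ∃ s ≤ t, ∃ i : ℤ, i < -m ∧ η s ω i = true} ≤
      ENNReal.ofReal (t * (z ^ 2 / (z - 1)) * z⁻¹ ^ (m + 1) * (1 - z⁻¹)⁻¹) := by
    refine (measure_mono hsub).trans ((measure_iUnion_le _).trans ((ENNReal.tsum_le_tsum hk).trans ?_))
    rw [← ENNReal.ofReal_tsum_of_nonneg (fun k => by positivity) hsum.summable, hsum.tsum_eq]
  refine (ENNReal.toReal_le_of_le_ofReal ?_ hle).trans_eq ?_
  · have : 0 ≤ 1 - z⁻¹ := by linarith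
    positivity
  · have : (1 - z⁻¹)⁻¹ = z / (z - 1) := by field_simp
    rw [this, pow_succ z⁻¹ m]
    generalize z⁻¹ ^ m = r
    field_simp

end Maximal

end ASEP

end

/-! ### Choice of constants and conclusion -/

theorem proposition2p1 (p : ℝ) (hp : 1 / 2 < p) (hp1 : p ≤ 1) :
    ∃ t₀ C₁ C₂ : ℝ, 0 < t₀ ∧ 0 < C₁ ∧ 0 < C₂ ∧
      ∀ {Ω : Type*} [MeasurableSpace Ω] (μ : Measure Ω) [IsProbabilityMeasure μ]
        (η : ℝ≥0 → Ω → ASEP.Config),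
        ASEP.IsASEP p μ η →
        (∀ᵐ ω ∂μ, η 0 ω = ASEP.reversedStep) →
        ∀ t : ℝ≥0, t₀ < (t : ℝ) →
          μ.real {ω | (⨅ ℓ ∈ Set.Icc (0 : ℝ≥0) t, ASEP.leftmost (η ℓ ω))
              < ((-(t : ℝ) ^ (1 / 4 : ℝ) : ℝ) : EReal)}
            ≤ C₁ * Real.exp (-C₂ * (t : ℝ) ^ (1 / 8 : ℝ)) := by
  -- Any `z > 1` with `(1 - p) * z ≤ p` would do; unlike `p / (1 - p)`, this choice also makes sense
  -- at `p = 1`.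
  set z : ℝ := (2 * p + 1) / (3 - 2 * p) with hz_def
  have h3 : 0 < 3 - 2 * p := by linarith
  have hz : 1 < z := by rw [hz_def, lt_div_iff₀ h3]; linarith
  have hzp : (1 - p) * z ≤ p := by
    rw [hz_def, mul_div_assoc', div_le_iff₀ h3]
    nlinarith
  have hz0 : 0 < z := by linarith
  have hz1 : 0 < z - 1 := by linarith
  have hlog : 0 < Real.log z := Real.log_pos hz
  set c := Real.log z / 2 with hc_def
  have hc : 0 < c := by positivity
  refine ⟨1, z ^ 3 / (z - 1) ^ 2 * (24 / c ^ 4), c, one_pos, by positivity, hc, ?_⟩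
  intro Ω _ μ _ η h h0 t ht
  set y : ℝ := (t : ℝ) ^ (1 / 4 : ℝ) with hy_def
  have ht0 : (0 : ℝ) ≤ t := t.coe_nonneg
  have hy0 : 0 ≤ y := by positivity
  have hy4 : y ^ 4 = t := by
    rw [hy_def, ← Real.rpow_natCast, ← Real.rpow_mul ht0]
    norm_num
  have h8 : (t : ℝ) ^ (1 / 8 : ℝ) ≤ y :=
    Real.rpow_le_rpow_of_exponent_le ht.le (by norm_num)
  set m := ⌊y⌋₊ with hm_def
  have hsub : {ω | (⨅ ℓ ∈ Set.Icc (0 : ℝ≥0) t, ASEP.leftmost (η ℓ ω)) < ((-y : ℝ) : EReal)} ⊆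
      {ω | ∃ s ≤ t, ∃ i : ℤ, i < -m ∧ η s ω i = true} := by
    intro ω hω
    simp only [Set.mem_ofPred_eq, ASEP.leftmost, iInf_lt_iff] at hω
    obtain ⟨s, hs, i, hi, hlt⟩ := hω
    refine ⟨s, hs.2, i, ?_, hi⟩
    have h1 : (i : ℝ) < -y := by exact_mod_cast hlt
    have h2 : (m : ℝ) ≤ y := Nat.floor_le hy0
    have h4 : (i : ℝ) < -m := by linarith
    exact_mod_cast h4
  refine (measureReal_mono hsub).trans
    ((h.measureReal_exists_occupied_lt_le h0 (by linarith) hp1 hz hzp m t).trans ?_)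
  -- The floor costs one factor `z`. Since `c` is half of `log z`, the decay splits in two: one
  -- exponential absorbs `t = y ^ 4`, via the term of order `4` (whence `24 = 4!`), and the other
  -- survives.
  have hpow : z⁻¹ ^ m ≤ z * Real.exp (-c * y) * Real.exp (-c * y) := by
    have h1 : z⁻¹ ^ m = Real.exp (-(Real.log z * m)) := by
      rw [Real.exp_neg, Real.exp_mul, Real.exp_log hz0, Real.rpow_natCast, inv_pow]
    have h2 : y < m + 1 := Nat.lt_floor_add_one y
    have h5 : z * Real.exp (-c * y) * Real.exp (-c * y) = Real.exp (Real.log z + -c * y + -c * y) := by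
      rw [Real.exp_add, Real.exp_add, Real.exp_log hz0]
    rw [h1, h5]
    refine Real.exp_le_exp.2 ?_
    rw [hc_def]
    nlinarith
  have hpoly : (t : ℝ) * Real.exp (-c * y) ≤ 24 / c ^ 4 := by
    have h1 := Real.pow_div_factorial_le_exp (c * y) (by positivity) 4
    rw [neg_mul, Real.exp_neg, ← div_eq_mul_inv, div_le_div_iff₀ (Real.exp_pos _) (by positivity),
      ← hy4]
    rw [div_le_iff₀ (by positivity), mul_pow] at h1
    norm_num [Nat.factorial] at h1
    linarith
  have hexp : Real.exp (-c * y) ≤ Real.exp (-c * (t : ℝ) ^ (1 / 8 : ℝ)) :=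
    Real.exp_le_exp.2 (by nlinarith)
  calc (t : ℝ) * (z ^ 2 / (z - 1) ^ 2) * z⁻¹ ^ m
      ≤ t * (z ^ 2 / (z - 1) ^ 2) * (z * Real.exp (-c * y) * Real.exp (-c * y)) := by gcongr
    _ = z ^ 3 / (z - 1) ^ 2 * (t * Real.exp (-c * y)) * Real.exp (-c * y) := by ring
    _ ≤ z ^ 3 / (z - 1) ^ 2 * (24 / c ^ 4) * Real.exp (-c * (t : ℝ) ^ (1 / 8 : ℝ)) := by gcongr
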